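/- Let $m>2$ be an integer with prime factorization $m=p_1^{a_1}\cdots p_k^{a_k}$, where $k\ge 1$, the primes $p_1,\dots,p_k$ are distinct and listed in any order, and all $a_j\ge 1$. Let $\Gamma(m)\subset SL_2(\mathbb Z)$ be the principal congruence subgroup of level $m$, i.e. the kernel of the reduction map $SL_2(\mathbb Z)\to SL_2(\mathbb Z/m)$. Let $M=\mathbb Z[x,y]$ with the action of $SL_2(\mathbb Z)$ by ring automorphisms that extends the natural action on $\mathbb Z^2=\mathbb Zx\oplus\mathbb Zy$, and let $M_n\subset M$ be the submodule of homogeneous polynomials of degree $n$. Then $$|SL_2(\mathbb Z/m)| = d := \prod_{j=1}^k p_j^{3(a_j-1)}\,p_j(p_j^2-1).$$ Put $i=\dfrac{d}{p_1(p_1^2-1)}$. Then $\Gamma(m)$ is a free group of rank $$r=\begin{cases} \dfrac{i}{2}+1 & \text{if } p_1=2,\\[2mm] i\,\dfrac{p_1(p_1^2-1)}{12}+1 & \text{if } p_1>2.\end{cases}$$ Moreover, the rank (dimension over $\mathbb Q$) of $H^1(\Gamma(m);M_n\otimes\mathbb Q)$ is $r$ for $n=0$ and $(r-1)(n+1)$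 for $n>0$. -/

import Mathlib

open scoped MatrixGroups TensorProduct

noncomputable section

namespace CongruenceCohomology

/-- The ring endomorphism of `ℤ[x, y]` attached to `g ∈ SL(2, ℤ)`: it sends the `j`-th variable to
`∑ i, g i j • X i`, i.e. it extends the natural action of `g` on column vectors
`ℤ² = ℤ x ⊕ ℤ y` to the symmetric algebra. -/
def polyAct (g : SL(2, ℤ)) : MvPolynomial (Fin 2) ℤ →ₐ[ℤ] MvPolynomial (Fin 2) ℤ :=
  MvPolynomial.aeval (fun j => ∑ i, MvPolynomial.C (g i j) * MvPolynomial.X i)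

theorem polyAct_X (g : SL(2, ℤ)) (j : Fin 2) :
    polyAct g (MvPolynomial.X j) = ∑ i, MvPolynomial.C (g i j) * MvPolynomial.X i := by
  simp [polyAct]

theorem polyAct_one : polyAct 1 = AlgHom.id ℤ _ := by
  apply MvPolynomial.algHom_ext
  intro j
  rw [polyAct_X]
  fin_cases j <;> simp

theorem polyAct_mul (g h : SL(2, ℤ)) : polyAct (g * h) = (polyAct g).comp (polyAct h) := by
  apply MvPolynomial.algHom_ext
  intro j
  have hC : ∀ c : ℤ, polyAct g (MvPolynomial.C c) = MvPolynomial.C c := fun c => by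
    simp [polyAct]
  simp only [AlgHom.comp_apply, polyAct_X, map_mul, hC, Fin.sum_univ_two,
    Matrix.SpecialLinearGroup.coe_mul, Matrix.mul_apply, map_add]
  ring

/-- The action of `SL(2, ℤ)` on `M = ℤ[x, y]`. -/
def polyRep : Representation ℤ SL(2, ℤ) (MvPolynomial (Fin 2) ℤ) where
  toFun g := (polyAct g).toLinearMap
  map_one' := by rw [polyAct_one]; rfl
  map_mul' g h := by rw [polyAct_mul]; rfl

theorem polyRep_mem (n : ℕ) (g : SL(2, ℤ)) ⦃f : MvPolynomial (Fin 2) ℤ⦄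
    (hf : f ∈ MvPolynomial.homogeneousSubmodule (Fin 2) ℤ n) :
    polyRep g f ∈ MvPolynomial.homogeneousSubmodule (Fin 2) ℤ n := by
  rw [MvPolynomial.mem_homogeneousSubmodule] at hf ⊢
  have h := MvPolynomial.IsHomogeneous.aeval hf
    (fun j => ∑ i, MvPolynomial.C (g i j) * MvPolynomial.X i : Fin 2 → MvPolynomial (Fin 2) ℤ)
    (n := 1) (fun j => MvPolynomial.IsHomogeneous.sum _ _ _
      (fun i _ => MvPolynomial.isHomogeneous_C_mul_X _ _))
  rwa [one_mul] at h

/-- `M n`: the homogeneous polynomials of degree `n` in `ℤ[x, y]`. -/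
abbrev M (n : ℕ) : Type := MvPolynomial.homogeneousSubmodule (Fin 2) ℤ n

/-- The action of `SL(2, ℤ)` on `M n`. -/
def homogRep (n : ℕ) : Representation ℤ SL(2, ℤ) (M n) :=
  (Subrepresentation.mk (ρ := polyRep) (MvPolynomial.homogeneousSubmodule (Fin 2) ℤ n)
    (polyRep_mem n)).toRepresentation

/-- The action of `SL(2, ℤ)` on `ℚ ⊗ M n` through the second factor. -/
def homogRepRat (n : ℕ) : Representation ℚ SL(2, ℤ) (ℚ ⊗[ℤ] M n) :=
  ((Module.End.baseChangeHom ℤ ℚ (M n) : Module.End ℤ (M n) →* Module.End ℚ (ℚ ⊗[ℤ] M n))).comp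
    (homogRep n)

/-- The rational group cohomology `H¹(Γ(m); M n ⊗ ℚ)`. -/
abbrev H1 (m n : ℕ) : ModuleCat ℚ :=
  groupCohomology
    (Rep.of ((homogRepRat n).comp (CongruenceSubgroup.Gamma m).subtype)) 1

end CongruenceCohomology

end

/-! The image of `Γ(m)` in `PSL₂(ℤ) ≅ ℤ/2 * ℤ/3` is free by a Kurosh-type argument. For `m > 2` it
is isomorphic to `Γ(m)`, because `-1 ∉ Γ(m)`, and it meets no conjugate of a free factor
nontrivially. Its index is `N = d/2`, where `d = |SL₂(ℤ/m)|`.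

For such a subgroup of a free product, each factor `H i` acts freely on the coset space. The action
groupoid is then free on edges forming a star in every factor orbit, and the subgroup is a vertex
group of it (`existsUnique_functor`, `exists_mulEquiv_freeGroup`). Counting vertices and edges gives
`r = 1 - N + N/2 + 2N/3 = 1 + d/12`, and both cases of the stated formula equal this number.

The free product decomposition comes from ping-pong for the congruence action `A ↦ g A gᵀ`, which
has kernel `{1, -1}`. The order `d` is computed by the Chinese remainder theorem and a count over
the local rings `ℤ/pᵃ`. Surjectivity of reduction identifies it with the index of `Γ(m)`.

For a free group of rank `r`, cocycles are arbitrary functions on a basis, so `dim H¹(A) = (r - 1)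
dim A + dim A^Γ`. The invariants are everything for `n = 0`. They vanish for `n > 0`, since a form
fixed by the two elementary matrices of level `m` is periodic along lines, hence constant on them.
-/

noncomputable section

/-! ### Action groupoids of free products and subgroups meeting the factors trivially -/

section FreeGroupoid

open CategoryTheory CategoryTheory.ActionCategory CategoryTheory.SingleObj

namespace FreeProductAction

open Monoid

variable {ι : Type} (H : ι → Type) [∀ i, Group (H i)] (X : Type) [MulAction (CoprodI H) X]

/-- The orbit relation of the `i`-th free factor. -/
def factorSetoid (i : ι) : Setoid X where
  r x y := ∃ h : H i, (CoprodI.of h : CoprodI H) • x = y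
  iseqv :=
    { refl := fun x => ⟨1, by simp⟩
      symm := by
        rintro x y ⟨h, rfl⟩
        exact ⟨h⁻¹, by rw [map_inv, inv_smul_smul]⟩
      trans := by
        rintro x y z ⟨h, rfl⟩ ⟨k, rfl⟩
        exact ⟨k * h, by rw [map_mul, mul_smul]⟩ }

variable {X}

/-- A chosen representative of the orbit of `x` under the `i`-th free factor. -/
def rep (i : ι) (x : X) : X := (Quotient.mk (factorSetoid H X i) x).out

theorem exists_smul_rep (i : ι) (x : X) : ∃ h : H i, (CoprodI.of h : CoprodI H) • rep H i x = x :=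
  Quotient.exact (s := factorSetoid H X i) (Quotient.out_eq _)

theorem rep_smul (i : ι) (h : H i) (x : X) : rep H i ((CoprodI.of h : CoprodI H) • x) = rep H i x := by
  unfold rep
  congr 1
  exact Quotient.sound (s := factorSetoid H X i)
    ⟨h⁻¹, by rw [map_inv, inv_smul_smul]⟩

/-- The element of the `i`-th free factor that moves the representative of the orbit of `x`
to `x`. -/
def displacement (i : ι) (x : X) : H i := (exists_smul_rep H i x).choose

@[simp]
theorem displacement_smul_rep (i : ι) (x : X) :
    (CoprodI.of (displacement H i x) : CoprodI H) • rep H i x = x :=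
  (exists_smul_rep H i x).choose_spec

@[simp]
theorem rep_rep (i : ι) (x : X) : rep H i (rep H i x) = rep H i x := by
  conv_rhs => rw [← displacement_smul_rep H i x, rep_smul]

variable (X) in
/-- Every free factor acts freely on `X`. -/
def FactorsActFreely : Prop :=
  ∀ (i : ι) (h : H i) (x : X), (CoprodI.of h : CoprodI H) • x = x → h = 1

variable {H}

/-- The displacement is a mere existential witness; freeness makes it unique and therefore
computable. -/
theorem FactorsActFreely.displacement_eq (hX : FactorsActFreely H X) {i : ι} {x y : X} {h : H i}
    (hx : rep H i x = x) (hy : (CoprodI.of h : CoprodI H) • x = y) : displacement H i y = h := by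
  have hr : rep H i y = x := by rw [← hy, rep_smul, hx]
  have h1 := displacement_smul_rep H i y
  rw [hr] at h1
  have h2 := hX i (h⁻¹ * displacement H i y) x (by
    rw [map_mul, mul_smul, h1, ← hy, map_inv, inv_smul_smul])
  rw [inv_mul_eq_one] at h2
  exact h2.symm

variable (H) in
/-- The edges that generate the action groupoid: for every orbit of a free factor, the star of
arrows from the chosen representative to the other points of the orbit. -/
def Edge (a b : X) : Type :=
  {e : Σ i, {h : H i // h ≠ 1} //
    rep H e.1 a = a ∧ (CoprodI.of (e.2 : H e.1) : CoprodI H) • a = b}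

open Classical in
/-- The potential of a labelling of the edges with respect to the `i`-th free factor. -/
def potential {C : Type} [Group C] (f : ∀ a b : X, Edge H a b → C) (i : ι) (x : X) : C :=
  if h : displacement H i x = 1 then 1
  else f (rep H i x) x ⟨⟨i, displacement H i x, h⟩, rep_rep H i x, displacement_smul_rep H i x⟩

theorem potential_rep (hX : FactorsActFreely H X) {C : Type} [Group C]
    (f : ∀ a b : X, Edge H a b → C) {i : ι} {x : X} (hx : rep H i x = x) :
    potential f i x = 1 :=
  dif_pos (hX.displacement_eq hx (by simp))

theorem potential_edge (hX : FactorsActFreely H X) {C : Type} [Group C]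
    (f : ∀ a b : X, Edge H a b → C) {a b : X} (e : Edge H a b) :
    potential f e.1.1 b = f a b e := by
  obtain ⟨⟨i, h, h1⟩, ha, hb⟩ := e
  dsimp only at ha hb ⊢
  have hd := hX.displacement_eq ha hb
  have hr : rep H i b = a := by rw [← hb, rep_smul, ha]
  subst hr
  subst hd
  exact dif_neg h1

/-- The homomorphism into the wreath product attached to a labelling of the edges. -/
def wreathHom {C : Type} [Group C] (f : ∀ a b : X, Edge H a b → C) :
    CoprodI H →* (X → C) ⋊[mulAutArrow] CoprodI H :=
  CoprodI.lift fun i =>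
    (MulAut.conj (SemidirectProduct.inl (potential f i))).toMonoidHom.comp
      (SemidirectProduct.inr.comp CoprodI.of)

theorem wreathHom_of {C : Type} [Group C] (f : ∀ a b : X, Edge H a b → C) {i : ι} (h : H i) :
    wreathHom f (CoprodI.of h) =
      ⟨fun b => potential f i b * (potential f i ((CoprodI.of h : CoprodI H)⁻¹ • b))⁻¹,
        CoprodI.of h⟩ := by
  simp only [wreathHom, CoprodI.lift_of]
  ext
  · simp
    rfl
  · simp

/-- The action groupoid of a free product whose factors act freely is a free groupoid. -/
theorem existsUnique_functor (hX : FactorsActFreely H X) {C : Type} [Group C]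
    (f : ∀ a b : X, Edge H a b → C) :
    ∃! F : ActionCategory (CoprodI H) X ⥤ SingleObj C,
      ∀ (a b : X) (e : Edge H a b),
        F.map (X := ((a : X) : ActionCategory (CoprodI H) X))
          (Y := ((b : X) : ActionCategory (CoprodI H) X))
          ⟨CoprodI.of (e.1.2 : H e.1.1), e.2.2⟩ = f a b e := by
  -- Functors to `C` are the same as homomorphisms to the wreath product that split the projection.
  -- These can be prescribed on each factor separately. Conjugating the standard splitting by the
  -- potential produces the required labels.
  refine ⟨uncurry (wreathHom f) ?_, ?_, ?_⟩
  · suffices SemidirectProduct.rightHom.comp (wreathHom f) = MonoidHom.id _ by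
      exact DFunLike.ext_iff.mp this
    refine CoprodI.ext_hom _ _ fun i => MonoidHom.ext fun h => ?_
    simp only [MonoidHom.comp_apply, wreathHom_of]
    rfl
  · intro a b e
    change (wreathHom f (CoprodI.of _)).left b = _
    rw [wreathHom_of]
    have h2 : (CoprodI.of (e.1.2 : H e.1.1) : CoprodI H)⁻¹ • b = a := by
      rw [inv_smul_eq_iff]; exact e.2.2.symm
    simp only [h2, potential_edge hX f e, potential_rep hX f e.2.1, inv_one, mul_one]
  · intro E hE
    -- On the arrow from the orbit representative to `x` the functor is forced: it is a label, or 1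
    -- if the arrow is an identity.
    have key : ∀ (i : ι) (x : X), E.map (X := ((rep H i x : X) : ActionCategory (CoprodI H) X))
        (Y := ((x : X) : ActionCategory (CoprodI H) X))
        ⟨CoprodI.of (displacement H i x), displacement_smul_rep H i x⟩ = potential f i x := by
      intro i x
      unfold potential
      split_ifs with h
      · have hx : rep H i x = x := by
          have := displacement_smul_rep H i x
          rwa [h, map_one, one_smul] at this
        have hid : ∀ (y : X) (q : CoprodI H) (hq : q • y = x), q = 1 → y = x →
            E.map (X := ((y : X) : ActionCategory (CoprodI H) X))
              (Y := ((x : X) : ActionCategory (CoprodI H) X)) ⟨q, hq⟩ = (1 : C) := by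
          rintro y q hq rfl rfl
          exact E.map_id _
        exact hid _ _ _ (by rw [h, map_one]) hx
      · exact hE _ _ ⟨⟨i, displacement H i x, h⟩, rep_rep H i x, displacement_smul_rep H i x⟩
    have : curry E = wreathHom f := by
      refine CoprodI.ext_hom _ _ fun i => MonoidHom.ext fun h => ?_
      simp only [MonoidHom.comp_apply, wreathHom_of]
      ext b
      · have hr : rep H i ((CoprodI.of h : CoprodI H)⁻¹ • b) = rep H i b := by
          rw [← map_inv, rep_smul]
        -- The arrow from the representative to `b` factors through `h⁻¹ • b`, so the value on the
        -- arrow `h` is a quotient of two potentials.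
        have hmul : ∀ (y : X) (q : CoprodI H) (hq : q • y = (CoprodI.of h : CoprodI H)⁻¹ • b)
            (q' : CoprodI H) (hq' : q' • y = b), q' = CoprodI.of h * q →
            (E.map (X := ((y : X) : ActionCategory (CoprodI H) X))
              (Y := ((b : X) : ActionCategory (CoprodI H) X)) ⟨q', hq'⟩ : C) =
            (E.map (homOfPair b (CoprodI.of h : CoprodI H)) : C) *
            (E.map (X := ((y : X) : ActionCategory (CoprodI H) X))
              (Y := (((CoprodI.of h : CoprodI H)⁻¹ • b : X) : ActionCategory (CoprodI H) X))
              ⟨q, hq⟩ : C) := by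
          rintro y q hq q' hq' rfl
          exact E.map_comp (X := ((y : X) : ActionCategory (CoprodI H) X))
              (Y := (((CoprodI.of h : CoprodI H)⁻¹ • b : X) : ActionCategory (CoprodI H) X))
              ⟨q, hq⟩ (homOfPair b (CoprodI.of h : CoprodI H))
        change (E.map (homOfPair b (CoprodI.of h : CoprodI H)) : C) = _
        rw [eq_mul_inv_iff_mul_eq, ← key, ← key]
        have hd : (CoprodI.of (displacement H i b) : CoprodI H) •
            rep H i ((CoprodI.of h : CoprodI H)⁻¹ • b) = b := by
          rw [hr, displacement_smul_rep]
        have hdd : displacement H i b = h * displacement H i ((CoprodI.of h : CoprodI H)⁻¹ • b) :=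
          hX.displacement_eq (rep_rep H i ((CoprodI.of h : CoprodI H)⁻¹ • b)) (by
            rw [map_mul, mul_smul, displacement_smul_rep, smul_inv_smul])
        rw [← hmul _ _ _ (CoprodI.of (displacement H i b)) hd (by rw [hdd, map_mul])]
        generalize rep H i ((CoprodI.of h : CoprodI H)⁻¹ • b) = y at hr hd
        subst hr
        rfl
      · rfl
    apply Functor.hext
    · intro
      apply Unit.ext
    · refine ActionCategory.cases ?_
      intro t g
      refine heq_of_eq ?_
      change _ = (wreathHom f g).left t
      rw [← this]
      rfl

/-- Functors from the action groupoid to a group correspond to labellings of the edges. -/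
def functorEquivLabelling (hX : FactorsActFreely H X) (C : Type) [Group C] :
    (ActionCategory (CoprodI H) X ⥤ SingleObj C) ≃ (∀ a b : X, Edge H a b → C) :=
  Equiv.ofBijective
    (fun F a b e => F.map (X := ((a : X) : ActionCategory (CoprodI H) X))
      (Y := ((b : X) : ActionCategory (CoprodI H) X)) ⟨CoprodI.of (e.1.2 : H e.1.1), e.2.2⟩)
    ⟨fun F F' h => (existsUnique_functor hX _).unique (fun _ _ _ => rfl)
        fun a b e => (congrFun (congrFun (congrFun h a) b) e).symm,
      fun f => by
        obtain ⟨F, hF, -⟩ := existsUnique_functor hX f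
        exact ⟨F, funext fun a => funext fun b => funext fun e => hF a b e⟩⟩

/-- The action groupoid is free on the edges. -/
@[reducible]
def isFreeGroupoid (hX : FactorsActFreely H X) :
    IsFreeGroupoid (ActionCategory (CoprodI H) X) where
  quiverGenerators := ⟨fun a b => Edge H (ActionCategory.back (M := CoprodI H) (X := X) a)
    (ActionCategory.back (M := CoprodI H) (X := X) b)⟩
  of := fun e => ⟨CoprodI.of (e.1.2 : H e.1.1), e.2.2⟩
  unique_lift := by
    intro C _ f
    obtain ⟨F, hF, hu⟩ := existsUnique_functor hX
      (fun a b e => f (a := ((a : X) : ActionCategory (CoprodI H) X))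
        (b := ((b : X) : ActionCategory (CoprodI H) X)) e)
    refine ⟨F, ?_, fun F' hF' => hu F' fun a b e => hF'
      ((a : X) : ActionCategory (CoprodI H) X) ((b : X) : ActionCategory (CoprodI H) X) e⟩
    rintro ⟨⟨⟩, a⟩ ⟨⟨⟩, b⟩ e
    exact hF a b e

variable (H X) in
/-- The edges, sorted by the free factor, the element of that factor, and the starting point. -/
def edgeEquiv : (Σ a b : X, Edge H a b) ≃ Σ i, {h : H i // h ≠ 1} × {x : X // rep H i x = x} where
  toFun e := ⟨e.2.2.1.1, e.2.2.1.2, e.1, e.2.2.2.1⟩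
  invFun e := ⟨e.2.2, (CoprodI.of (e.2.1 : H e.1) : CoprodI H) • (e.2.2 : X), ⟨e.1, e.2.1⟩,
    e.2.2.2, rfl⟩
  left_inv := by
    rintro ⟨a, b, ⟨⟨i, h⟩, ha, hb⟩⟩
    dsimp only at ha hb ⊢
    subst hb
    rfl
  right_inv := by
    rintro ⟨i, h, x⟩
    rfl

/-- A set on which a free factor acts freely is the product of that factor and a transversal. -/
def factorEquiv (hX : FactorsActFreely H X) (i : ι) : X ≃ H i × {x : X // rep H i x = x} where
  toFun x := ⟨displacement H i x, rep H i x, rep_rep H i x⟩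
  invFun p := (CoprodI.of p.1 : CoprodI H) • (p.2 : X)
  left_inv x := displacement_smul_rep H i x
  right_inv := by
    rintro ⟨h, x, hx⟩
    refine Prod.ext (hX.displacement_eq hx rfl) (Subtype.ext ?_)
    simp only [rep_smul, hx]

end FreeProductAction

/-- Functors from a connected groupoid to a commutative group are determined by their values
on a vertex group and on a star of arrows. -/
theorem CategoryTheory.functor_singleObj_bijective {G : Type} [Groupoid.{0} G] (r : G)
    (t : ∀ a : G, r ⟶ a) (ht : t r = 𝟙 r) (C : Type) [CommGroup C] :
    Function.Bijective
      (fun F : G ⥤ SingleObj C =>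
        (((F.mapEnd r : End r →* C), (fun a => F.map (t a) : {a : G // a ≠ r} → C)) :
          (End r →* C) × ({a : G // a ≠ r} → C))) := by
  classical
  -- Every arrow is a loop at `r` conjugated by the chosen star of arrows.
  have hdec : ∀ (F : G ⥤ SingleObj C) {a b : G} (p : a ⟶ b),
      (F.map p : C) = (F.map (t b) : C) * (F.map (t a ≫ p ≫ inv (t b)) : C) * (F.map (t a) : C)⁻¹ := by
    intro F a b p
    rw [F.map_comp, F.map_comp, F.map_inv, comp_as_mul, comp_as_mul, inv_as_inv]
    group
  constructor
  · intro F F' h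
    have h1 : ∀ p : End r, (F.map p : C) = F'.map p := fun p =>
      DFunLike.congr_fun (Prod.ext_iff.mp h).1 p
    have h2 : ∀ a, (F.map (t a) : C) = F'.map (t a) := by
      intro a
      by_cases ha : a = r
      · subst ha
        exact h1 _
      · exact congrFun (Prod.ext_iff.mp h).2 ⟨a, ha⟩
    refine Functor.hext (fun _ => rfl) fun a b p => heq_of_eq ?_
    exact (hdec F p).trans (by rw [h2, h2, h1, ← hdec F' p])
  · rintro ⟨φ, ψ⟩
    -- The value at `r` must be 1, because `t r` is the identity.
    let ψ' : G → C := fun a => if h : a = r then 1 else ψ ⟨a, h⟩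
    have hr : ψ' r = 1 := dif_pos rfl
    let F : G ⥤ SingleObj C :=
      { obj := fun _ => ()
        map := fun {a b} p => (ψ' b * φ (t a ≫ p ≫ inv (t b)) * (ψ' a)⁻¹ : C)
        map_id := by
          intro a
          have : t a ≫ 𝟙 a ≫ inv (t a) = 𝟙 r := by simp
          rw [this]
          change ψ' a * φ 1 * (ψ' a)⁻¹ = 1
          rw [map_one, mul_one, mul_inv_cancel]
        map_comp := by
          intro a b c p q
          have : t a ≫ (p ≫ q) ≫ inv (t c) =
            (t a ≫ p ≫ inv (t b)) ≫ (t b ≫ q ≫ inv (t c)) := by simp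
          rw [this, comp_as_mul]
          have hφ : ∀ x y : End r, φ (x ≫ y : r ⟶ r) = φ y * φ x := fun x y => φ.map_mul y x
          rw [hφ]
          exact (by intros; group : ∀ u v w x y : C, u * (y * x) * w⁻¹ = u * y * v⁻¹ * (v * x * w⁻¹))
            (ψ' c) (ψ' b) (ψ' a) _ _ }
    refine ⟨F, Prod.ext (MonoidHom.ext fun p => ?_) (funext fun a => ?_)⟩
    · change ψ' r * φ (t r ≫ p ≫ inv (t r)) * (ψ' r)⁻¹ = φ p
      rw [hr, ht]
      simp
    · change ψ' a * φ (t r ≫ t a ≫ inv (t a)) * (ψ' r)⁻¹ = ψ a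
      have : t r ≫ t a ≫ inv (t a) = 𝟙 r := by simp [ht]
      rw [this, hr]
      change ψ' a * φ 1 * 1⁻¹ = _
      rw [map_one, inv_one, mul_one, mul_one]
      exact dif_neg a.2

/-- The rank of a vertex group of a connected free groupoid with finitely many vertices and
edges. -/
theorem IsFreeGroupoid.exists_end_mulEquiv {G : Type} [Groupoid.{0} G] [IsConnected G]
    [IsFreeGroupoid G] [Finite G] {E : Type} [Finite E]
    (e : (G ⥤ SingleObj (Multiplicative (ZMod 2))) ≃ (E → Multiplicative (ZMod 2))) (r₀ : G) :
    ∃ r : ℕ, Nonempty (End r₀ ≃* FreeGroup (Fin r)) ∧ r + Nat.card G = 1 + Nat.card E := by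
  classical
  obtain ⟨t, ht⟩ : ∃ t : ∀ a : G, r₀ ⟶ a, t r₀ = 𝟙 r₀ := by
    have hne : ∀ a : G, Nonempty (r₀ ⟶ a) := fun a =>
      CategoryTheory.nonempty_hom_of_preconnected_groupoid r₀ a
    refine ⟨fun a => if h : r₀ = a then eqToHom h else (hne a).some, by simp⟩
  -- Counting functors to a group of order 2 in two ways gives `2 ^ rank * 2 ^ (V - 1) = 2 ^ E`, for
  -- `V` vertices and `E` edges.
  let C := Multiplicative (ZMod 2)
  have hC : Nat.card C = 2 := by simp [C]
  let I := IsFreeGroup.Generators (End r₀)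
  have e1 : ((I → C) × ({a : G // a ≠ r₀} → C)) ≃ (E → C) :=
    ((IsFreeGroup.lift (G := End r₀) (H := C)).prodCongr (Equiv.refl _)).trans
      ((Equiv.ofBijective _ (CategoryTheory.functor_singleObj_bijective r₀ t ht C)).symm.trans e)
  have : Finite (I → C) := by
    have : Finite ((I → C) × ({a : G // a ≠ r₀} → C)) := Finite.of_equiv _ e1.symm
    exact Finite.of_injective (fun f : I → C => (f, fun _ : {a : G // a ≠ r₀} => (1 : C)))
      fun f g h => (Prod.ext_iff.mp h).1
  have : Finite I := by
    refine Finite.of_injective (fun i : I => (Pi.mulSingle i (Multiplicative.ofAdd 1) : I → C)) ?_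
    intro i j hij
    by_contra hne
    have := congrFun hij i
    simp only [Pi.mulSingle_eq_same, Pi.mulSingle_eq_of_ne hne] at this
    exact absurd this (by decide)
  have hcount := Nat.card_congr e1
  rw [Nat.card_prod, Nat.card_fun, Nat.card_fun, Nat.card_fun, hC, ← pow_add] at hcount
  have hadd := Nat.pow_right_injective le_rfl hcount
  have hVr : Nat.card {a : G // a ≠ r₀} + 1 = Nat.card G := by
    rw [← Finite.card_option]
    exact Nat.card_congr (Equiv.optionSubtypeNe r₀)
  exact ⟨Nat.card I, ⟨(IsFreeGroup.toFreeGroup (End r₀)).trans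
    (FreeGroup.freeGroupCongr (Finite.equivFin I))⟩, by omega⟩

namespace FreeProductAction

open Monoid

/-- A subgroup of finite index of a free product of finitely many finite groups that meets the
conjugates of the factors trivially is free, of the rank given by the Euler characteristic. -/
theorem exists_mulEquiv_freeGroup {ι : Type} [Fintype ι] {H : ι → Type} [∀ i, Group (H i)]
    [∀ i, Finite (H i)] (N : Subgroup (CoprodI H)) [N.FiniteIndex]
    (hN : ∀ (i : ι) (h : H i) (q : CoprodI H), q⁻¹ * CoprodI.of h * q ∈ N → h = 1) :
    (∀ i, Nat.card (H i) ∣ N.index) ∧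
    ∃ r : ℕ, Nonempty (N ≃* FreeGroup (Fin r)) ∧
      r + N.index = 1 + ∑ i, (Nat.card (H i) - 1) * (N.index / Nat.card (H i)) := by
  classical
  -- The stabiliser of the coset `qN` is `q N q⁻¹`, so the hypothesis on conjugates is exactly
  -- freeness.
  have hX : FactorsActFreely H (CoprodI H ⧸ N) := by
    intro i h x hx
    induction x using QuotientGroup.induction_on with
    | H q =>
      have h1 := QuotientGroup.eq.mp hx
      have h2 := hN i h⁻¹ q (by simpa [mul_assoc] using h1)
      simpa using h2
  have hcard : ∀ i, N.index = Nat.card (H i) * Nat.card {x : CoprodI H ⧸ N // rep H i x = x} :=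
    fun i => by
      rw [← Nat.card_prod]
      exact Nat.card_congr (factorEquiv hX i)
  refine ⟨fun i => ⟨_, hcard i⟩, ?_⟩
  let _ := isFreeGroupoid hX
  have : Finite (ActionCategory (CoprodI H) (CoprodI H ⧸ N)) :=
    Finite.of_equiv _ (objEquiv (CoprodI H) (CoprodI H ⧸ N))
  have : @IsConnected (ActionCategory (CoprodI H) (CoprodI H ⧸ N)) Groupoid.toCategory :=
    (inferInstance : IsConnected (ActionCategory (CoprodI H) (CoprodI H ⧸ N)))
  obtain ⟨r, ⟨f⟩, hr⟩ := IsFreeGroupoid.exists_end_mulEquiv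
    ((functorEquivLabelling hX (Multiplicative (ZMod 2))).trans
      (({ toFun := fun f e => f e.1 e.2.1 e.2.2
          invFun := fun f a b e => f ⟨a, b, e⟩
          left_inv := fun _ => rfl
          right_inv := fun _ => rfl } :
          (∀ a b : CoprodI H ⧸ N, Edge H a b → Multiplicative (ZMod 2)) ≃
            ((Σ a b : CoprodI H ⧸ N, Edge H a b) → Multiplicative (ZMod 2))).trans
        (Equiv.arrowCongr (edgeEquiv H (CoprodI H ⧸ N)) (Equiv.refl _))))
    (objEquiv (CoprodI H) (CoprodI H ⧸ N) ((1 : CoprodI H) : CoprodI H ⧸ N))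
  refine ⟨r, ⟨(endMulEquivSubgroup N).symm.trans f⟩, ?_⟩
  have hV : Nat.card (ActionCategory (CoprodI H) (CoprodI H ⧸ N)) = N.index :=
    (Nat.card_congr (objEquiv (CoprodI H) (CoprodI H ⧸ N))).symm
  rw [hV, Nat.card_sigma] at hr
  rw [hr]
  congr 1
  refine Finset.sum_congr rfl fun i _ => ?_
  rw [Nat.card_prod]
  congr 1
  · rw [← Nat.card_congr (Equiv.optionSubtypeNe (1 : H i)), Finite.card_option, Nat.add_sub_cancel]
  · rw [hcard i, Nat.mul_div_cancel_left _ Nat.card_pos]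

end FreeProductAction

end FreeGroupoid

/-! ### First cohomology of free groups -/

theorem FreeGroupBasis.closure_range {I G : Type*} [Group G] (b : FreeGroupBasis I G) :
    Subgroup.closure (Set.range b) = ⊤ := by
  have h := congrArg (Subgroup.map b.repr.symm.toMonoidHom) (FreeGroup.closure_range_of I)
  rw [MonoidHom.map_closure, ← Set.range_comp,
    Subgroup.map_top_of_surjective _ b.repr.symm.surjective] at h
  exact h

namespace groupCohomology

variable {k : Type} [Field k] {G : Type} [Group G]

/-- A 1-cocycle that vanishes on a generating set is zero. -/
theorem cocycles₁_eq_zero_of_closure {A : Rep.{0} k G} (f : cocycles₁ A) {s : Set G}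
    (hs : Subgroup.closure s = ⊤) (h : ∀ g ∈ s, f g = 0) : f = 0 := by
  refine cocycles₁_ext fun g => ?_
  have hg : g ∈ Subgroup.closure s := hs ▸ Subgroup.mem_top g
  have hmul : ∀ g h : G, f (g * h) = A.ρ g (f h) + f g := (mem_cocycles₁_iff f.1).1 f.2
  change f g = 0
  induction hg using Subgroup.closure_induction with
  | mem x hx => exact h x hx
  | one => exact cocycles₁_map_one f
  | mul x y _ _ hx hy => rw [hmul, hx, hy, map_zero, add_zero]
  | inv x _ hx =>
    have := hmul x⁻¹ x
    rw [inv_mul_cancel, cocycles₁_map_one, hx, map_zero, zero_add] at this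
    exact this.symm

/-- The values of a 1-cocycle on a family of group elements. -/
def cocycles₁Eval (A : Rep.{0} k G) {I : Type} (b : I → G) : cocycles₁ A →ₗ[k] (I → A) where
  toFun f i := f (b i)
  map_add' _ _ := rfl
  map_smul' _ _ := rfl

/-- A 1-cocycle on a free group is determined by its values on a basis, and these values are
arbitrary. -/
theorem cocycles₁Eval_bijective (A : Rep.{0} k G) {I : Type} (b : FreeGroupBasis I G) :
    Function.Bijective (cocycles₁Eval A b) := by
  constructor
  · rw [injective_iff_map_eq_zero]
    intro f hf
    refine cocycles₁_eq_zero_of_closure f b.closure_range ?_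
    rintro _ ⟨i, rfl⟩
    exact congrFun hf i
  · intro v
    -- A cocycle is the translation part of an affine action. Freeness extends the affine maps `x ↦
    -- b i • x + v i` to all of `G`.
    let F : G →* Equiv.Perm A := b.lift fun i =>
      { toFun := fun x => A.ρ (b i) x + v i
        invFun := fun x => A.ρ (b i)⁻¹ (x - v i)
        left_inv := fun x => by simp [Representation.inv_self_apply]
        right_inv := fun x => by simp [Representation.self_inv_apply] }
    have hb : ∀ i x, F (b i) x = A.ρ (b i) x + v i := fun i x => by
      simp only [F, FreeGroupBasis.lift_apply_apply, FreeGroupBasis.repr_apply_coe,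
        FreeGroup.lift_apply_of]
      rfl
    have hF : ∀ g x, F g x = A.ρ g x + F g 0 := by
      intro g
      have hg : g ∈ Subgroup.closure (Set.range b) := b.closure_range ▸ Subgroup.mem_top g
      induction hg using Subgroup.closure_induction with
      | mem x hx =>
        obtain ⟨i, rfl⟩ := hx
        intro x
        rw [hb, hb, map_zero, zero_add]
      | one => intro x; simp
      | mul x y _ _ hx hy =>
        intro z
        rw [map_mul, Equiv.Perm.mul_apply, Equiv.Perm.mul_apply, hx, hy, hx (F y 0), map_add,
          map_mul, Module.End.mul_apply, add_assoc]
      | inv x _ hx =>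
        intro z
        rw [map_inv, Equiv.Perm.inv_eq_iff_eq, hx, map_add, Representation.self_inv_apply,
          add_assoc, ← hx, ← Equiv.Perm.mul_apply, mul_inv_cancel, Equiv.Perm.one_apply, add_zero]
    refine ⟨⟨fun g => F g 0, (mem_cocycles₁_iff _).2 fun g h => ?_⟩, ?_⟩
    · rw [map_mul, Equiv.Perm.mul_apply, hF]
    · ext i
      change F (b i) 0 = v i
      rw [hb, map_zero, zero_add]

/-- The Euler characteristic of a free group with coefficients in a finite-dimensional
representation. -/
theorem finrank_H1_of_freeGroupBasis (A : Rep.{0} k G) [FiniteDimensional k A] {r : ℕ}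
    (b : FreeGroupBasis (Fin r) G) :
    Module.Finite k (groupCohomology A 1) ∧
    Module.finrank k (groupCohomology A 1) + Module.finrank k A =
      r * Module.finrank k A + Module.finrank k A.ρ.invariants := by
  let e : cocycles₁ A ≃ₗ[k] (Fin r → A) :=
    LinearEquiv.ofBijective _ (cocycles₁Eval_bijective A b)
  have hfin : Module.Finite k (cocycles₁ A) := Module.Finite.equiv e.symm
  have hZ : Module.finrank k (cocycles₁ A) = r * Module.finrank k A := by
    rw [e.finrank_eq, Module.finrank_pi_fintype]
    simp
  let q : cocycles₁ A →ₗ[k] groupCohomology A 1 := (H1π A).hom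
  have hq : Function.Surjective q := (ModuleCat.epi_iff_surjective (H1π A)).1 inferInstance
  have hker : Module.finrank k (LinearMap.ker q) = Module.finrank k (coboundaries₁ A) := by
    have hk : LinearMap.ker q = (coboundaries₁ A).comap (cocycles₁ A).subtype := by
      ext x
      exact H1π_eq_zero_iff x
    rw [hk]
    exact (Submodule.comapSubtypeEquivOfLe (coboundaries₁_le_cocycles₁ A)).finrank_eq
  have h1 := q.finrank_range_add_finrank_ker
  rw [LinearMap.range_eq_top.2 hq, finrank_top, hker, hZ] at h1
  -- Coboundaries are the image of `A`, with the invariants as kernel.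
  have h2 := (d₀₁ A).hom.finrank_range_add_finrank_ker
  rw [d₀₁_ker_eq_invariants] at h2
  change Module.finrank k (coboundaries₁ A) + Module.finrank k A.ρ.invariants =
    Module.finrank k A at h2
  exact ⟨Module.Finite.of_surjective q hq, by omega⟩

end groupCohomology

/-! ### Binary forms and their invariants under `Γ(m)` -/

namespace CongruenceCohomology
open MvPolynomial

/-- The coefficients of a binary form. -/
def coeffMap (n : ℕ) : M n →ₗ[ℤ] (Finset.HasAntidiagonal.antidiagonal n → ℤ) where
  toFun f p := coeff (Finsupp.single 0 p.1.1 + Finsupp.single 1 p.1.2) (f : MvPolynomial (Fin 2) ℤ)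
  map_add' f g := by ext p; simp
  map_smul' c f := by ext p; exact coeff_smul _ c (f : MvPolynomial (Fin 2) ℤ)

theorem coeffMap_bijective (n : ℕ) : Function.Bijective (coeffMap n) := by
  constructor
  · rw [injective_iff_map_eq_zero]
    intro f hf
    refine Subtype.ext (MvPolynomial.ext _ _ fun d => ?_)
    rw [ZeroMemClass.coe_zero, coeff_zero]
    by_cases hd : d.degree = n
    · have hd' : d = Finsupp.single 0 (d 0) + Finsupp.single 1 (d 1) := by
        ext i
        fin_cases i <;> simp
      have hmem : (d 0, d 1) ∈ Finset.HasAntidiagonal.antidiagonal n := by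
        rw [Finset.HasAntidiagonal.mem_antidiagonal, ← hd, Finsupp.degree_eq_sum, Fin.sum_univ_two]
      have := congrFun hf ⟨_, hmem⟩
      rw [hd']
      exact this
    · exact ((mem_homogeneousSubmodule n _).1 f.2).coeff_eq_zero hd
  · intro c
    refine ⟨⟨∑ p : Finset.HasAntidiagonal.antidiagonal n,
      monomial (Finsupp.single 0 p.1.1 + Finsupp.single 1 p.1.2) (c p), ?_⟩, ?_⟩
    · refine Submodule.sum_mem _ fun p _ => isHomogeneous_monomial _ ?_
      rw [map_add, Finsupp.degree_single, Finsupp.degree_single]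
      exact Finset.HasAntidiagonal.mem_antidiagonal.1 p.2
    · ext p
      change coeff _ (∑ q : Finset.HasAntidiagonal.antidiagonal n, _) = _
      rw [coeff_sum, Finset.sum_eq_single p]
      · simp
      · intro q _ hq
        rw [coeff_monomial, if_neg]
        intro h
        refine hq (Subtype.ext (Prod.ext ?_ ?_))
        · simpa using DFunLike.congr_fun h 0
        · simpa using DFunLike.congr_fun h 1
      · simp

/-- Binary forms of degree `n` are given by their coefficients. -/
def coeffEquiv (n : ℕ) : M n ≃ₗ[ℤ] (Finset.HasAntidiagonal.antidiagonal n → ℤ) :=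
  LinearEquiv.ofBijective _ (coeffMap_bijective n)

instance (n : ℕ) : Module.Free ℤ (M n) := Module.Free.of_equiv (coeffEquiv n).symm

instance (n : ℕ) : Module.Finite ℤ (M n) := Module.Finite.equiv (coeffEquiv n).symm

theorem finrank_rat_M (n : ℕ) : Module.finrank ℚ (ℚ ⊗[ℤ] M n) = n + 1 := by
  rw [Module.finrank_baseChange, (coeffEquiv n).finrank_eq, Module.finrank_fintype_fun_eq_card,
    Fintype.card_coe, Finset.Nat.card_antidiagonal]

theorem homogRepRat_tmul (n : ℕ) (g : SL(2, ℤ)) (q : ℚ) (f : M n) :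
    homogRepRat n g (q ⊗ₜ f) = q ⊗ₜ homogRep n g f := rfl

theorem homogRep_coe (n : ℕ) (g : SL(2, ℤ)) (f : M n) :
    (homogRep n g f : MvPolynomial (Fin 2) ℤ) = polyAct g (f : MvPolynomial (Fin 2) ℤ) := rfl

theorem homogRepRat_zero (g : SL(2, ℤ)) (v : ℚ ⊗[ℤ] M 0) : homogRepRat 0 g v = v := by
  induction v with
  | zero => rw [map_zero]
  | add x y hx hy => rw [map_add, hx, hy]
  | tmul q f =>
    rw [homogRepRat_tmul]
    congr 1
    refine Subtype.ext ?_
    rw [homogRep_coe]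
    have hf : (f : MvPolynomial (Fin 2) ℤ).totalDegree = 0 :=
      Nat.le_zero.mp ((mem_homogeneousSubmodule 0 _).1 f.2).totalDegree_le
    rw [totalDegree_eq_zero_iff_eq_C] at hf
    rw [hf]
    simp [polyAct]

/-- Invariance of a form becomes invariance of its values under the transposed matrix, so it can be
tested at integer points. -/
theorem eval_polyAct (g : SL(2, ℤ)) (v : Fin 2 → ℤ) (f : MvPolynomial (Fin 2) ℤ) :
    eval v (polyAct g f) = eval (fun j => ∑ i, g i j * v i) f := by
  induction f using MvPolynomial.induction_on with
  | C a => simp [polyAct]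
  | add p q hp hq => rw [map_add, map_add, hp, hq, map_add]
  | mul_X p i hp => rw [map_mul, map_mul, hp, polyAct_X, map_mul, eval_X]; simp

/-- A function in one variable that is given by a polynomial and periodic is constant. -/
theorem eval_periodic {p : Polynomial ℤ} {c : ℤ} (hc : c ≠ 0)
    (h : ∀ x, p.eval (x + c) = p.eval x) (x : ℤ) : p.eval x = p.eval 0 := by
  have h1 : ∀ k : ℕ, p.eval (k * c) = p.eval 0 := by
    intro k
    induction k with
    | zero => simp
    | succ k ih => rw [← ih, ← h (k * c)]; push_cast; ring_nf
  have h2 : p = Polynomial.C (p.eval 0) := by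
    refine Polynomial.eq_of_infinite_eval_eq _ _ (Set.infinite_of_injective_forall_mem
      (f := fun k : ℕ => (k : ℤ) * c) (fun a b hab => ?_) fun k => ?_)
    · exact_mod_cast mul_right_cancel₀ hc hab
    · simp [h1 k]
  rw [h2]
  simp

theorem polynomial_eval_aeval (g : Fin 2 → Polynomial ℤ) (f : MvPolynomial (Fin 2) ℤ) (x : ℤ) :
    (aeval g f).eval x = eval (fun i => (g i).eval x) f := by
  induction f using MvPolynomial.induction_on with
  | C a => simp
  | add p q hp hq => rw [map_add, Polynomial.eval_add, hp, hq, map_add]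
  | mul_X p i hp => rw [map_mul, Polynomial.eval_mul, hp, aeval_X, map_mul, eval_X]

/-- A binary form of positive degree fixed by the two elementary matrices of level `m` vanishes. -/
theorem eq_zero_of_periodic {n : ℕ} (hn : 0 < n) {m : ℤ} (hm : m ≠ 0)
    {f : MvPolynomial (Fin 2) ℤ} (hf : f.IsHomogeneous n)
    (h1 : ∀ a b : ℤ, eval ![a, b + m * a] f = eval ![a, b] f)
    (h2 : ∀ a b : ℤ, eval ![a + m * b, b] f = eval ![a, b] f) : f = 0 := by
  have e1 : ∀ a b : ℤ, a ≠ 0 → eval ![a, b] f = eval ![a, 0] f := by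
    intro a b ha
    have hp : ∀ x, (aeval ![Polynomial.C a, Polynomial.X] f : Polynomial ℤ).eval x =
        eval ![a, x] f := by
      intro x
      rw [polynomial_eval_aeval]
      congr 2
      ext i
      fin_cases i <;> simp
    rw [← hp, ← hp]
    exact eval_periodic (mul_ne_zero hm ha) (fun x => by rw [hp, hp, h1]) b
  have e2 : ∀ a b : ℤ, b ≠ 0 → eval ![a, b] f = eval ![0, b] f := by
    intro a b hb
    have hp : ∀ x, (aeval ![Polynomial.X, Polynomial.C b] f : Polynomial ℤ).eval x =
        eval ![x, b] f := by
      intro x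
      rw [polynomial_eval_aeval]
      congr 2
      ext i
      fin_cases i <;> simp
    rw [← hp, ← hp]
    exact eval_periodic (mul_ne_zero hm hb) (fun x => by rw [hp, hp, h2]) a
  have hs : ∀ c a b : ℤ, eval ![c * a, c * b] f = c ^ n * eval ![a, b] f := by
    intro c a b
    rw [eval_eq', eval_eq', Finset.mul_sum]
    refine Finset.sum_congr rfl fun d hd => ?_
    have hdn : d 0 + d 1 = n := by
      by_contra hne
      refine mem_support_iff.1 hd (hf.coeff_eq_zero ?_)
      rwa [Finsupp.degree_eq_sum, Fin.sum_univ_two]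
    simp only [Fin.prod_univ_two, Matrix.cons_val_zero, Matrix.cons_val_one, ← hdn]
    ring
  -- Move from `(a, b)` to `(1, 1)` along lines parallel to the axes, on which `f` is constant.
  have e3 : ∀ a b : ℤ, a ≠ 0 → eval ![a, b] f = eval ![1, 1] f := by
    intro a b ha
    rw [e1 a b ha, ← e1 a 1 ha, e2 a 1 one_ne_zero, ← e2 1 1 one_ne_zero]
  have e4 : eval ![1, 1] f = 0 := by
    -- Homogeneity at `(2, 2)` gives `f(1, 1) = 2 ^ n * f(1, 1)`, and `2 ^ n ≠ 1` as `n > 0`.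
    have h := hs 2 1 1
    rw [e3 (2 * 1) (2 * 1) (by norm_num)] at h
    have h2n : (2 : ℤ) ^ n ≠ 1 := (one_lt_pow₀ (by norm_num) hn.ne').ne'
    by_contra hne
    exact h2n (mul_right_cancel₀ hne (by rw [one_mul]; exact h.symm))
  refine MvPolynomial.funext fun v => ?_
  have hv : v = ![v 0, v 1] := by ext i; fin_cases i <;> rfl
  rw [hv, map_zero]
  by_cases ha : v 0 = 0
  · by_cases hb : v 1 = 0
    · have := hs 0 1 1
      rw [zero_mul, zero_pow hn.ne', zero_mul] at this
      rw [ha, hb, this]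
    · rw [ha, ← e2 1 _ hb, e3 _ _ one_ne_zero, e4]
  · rw [e3 _ _ ha, e4]

theorem eq_zero_of_Gamma_invariant {m n : ℕ} (hm : m ≠ 0) (hn : 0 < n) (f : M n)
    (h : ∀ g ∈ CongruenceSubgroup.Gamma m, homogRep n g f = f) : f = 0 := by
  have hm' : (m : ℤ) ≠ 0 := Nat.cast_ne_zero.2 hm
  have key : ∀ g ∈ CongruenceSubgroup.Gamma m, ∀ v, eval (fun j => ∑ i, g i j * v i)
      (f : MvPolynomial (Fin 2) ℤ) = eval v (f : MvPolynomial (Fin 2) ℤ) := by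
    intro g hg v
    rw [← eval_polyAct, ← homogRep_coe, h g hg]
  refine Subtype.ext (eq_zero_of_periodic hn hm' ((mem_homogeneousSubmodule n _).1 f.2) ?_ ?_)
  · intro a b
    have := key ⟨!![1, (m : ℤ); 0, 1], by simp [Matrix.det_fin_two]⟩
      (CongruenceSubgroup.Gamma_mem.2 (by simp)) ![a, b]
    rw [← this]
    congr 2
    ext j
    fin_cases j <;> simp [Fin.sum_univ_two, add_comm]
  · intro a b
    have := key ⟨!![1, 0; (m : ℤ), 1], by simp [Matrix.det_fin_two]⟩
      (CongruenceSubgroup.Gamma_mem.2 (by simp)) ![a, b]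
    rw [← this]
    congr 2
    ext j
    fin_cases j <;> simp [Fin.sum_univ_two]

/-- Since `ℚ ⊗ M n` is the localisation of the torsion-free module `M n` at the nonzero integers, a
multiple of an invariant vector comes from an invariant integral form. -/
theorem invariants_eq_bot {m n : ℕ} (hm : m ≠ 0) (hn : 0 < n) :
    Representation.invariants
      ((homogRepRat n).comp (CongruenceSubgroup.Gamma m).subtype) = ⊥ := by
  rw [eq_bot_iff]
  intro v hv
  rw [Representation.mem_invariants] at hv
  rw [Submodule.mem_bot]
  have hloc : IsLocalizedModule (nonZeroDivisors ℤ) (TensorProduct.mk ℤ ℚ (M n) 1) := inferInstance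
  obtain ⟨⟨w, s⟩, hw⟩ := hloc.surj v
  have hs : ((s : ℤ) : ℚ) ≠ 0 := Int.cast_ne_zero.2 (nonZeroDivisors.coe_ne_zero s)
  have hw' : ((s : ℤ) : ℚ) • v = (1 : ℚ) ⊗ₜ[ℤ] w := by
    rw [Int.cast_smul_eq_zsmul]; exact hw
  have hw0 : w = 0 := by
    refine eq_zero_of_Gamma_invariant hm hn w fun g hg => ?_
    have h1 : (1 : ℚ) ⊗ₜ[ℤ] homogRep n g w = (1 : ℚ) ⊗ₜ[ℤ] w := by
      rw [← homogRepRat_tmul, ← hw', map_smul]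
      congr 1
      exact hv ⟨g, hg⟩
    obtain ⟨c, hc⟩ := (IsLocalizedModule.eq_iff_exists (nonZeroDivisors ℤ)
      (TensorProduct.mk ℤ ℚ (M n) 1)).1 h1
    exact smul_right_injective _ (nonZeroDivisors.coe_ne_zero c) hc
  rw [hw0, TensorProduct.tmul_zero] at hw'
  exact (smul_eq_zero.1 hw').resolve_left hs

/-- The Euler characteristic formula, with invariants of dimension 1 for `n = 0` and 0 for `n > 0`.
The condition `1 ≤ r` makes the natural number subtraction genuine. -/
theorem rank_H1 {m r : ℕ} (hm : m ≠ 0) (e : CongruenceSubgroup.Gamma m ≃* FreeGroup (Fin r)) :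
    Module.rank ℚ (H1 m 0) = (r : Cardinal) ∧
    ∀ n : ℕ, 0 < n → 1 ≤ r → Module.rank ℚ (H1 m n) = (((r - 1) * (n + 1) : ℕ) : Cardinal) := by
  have key := fun n => groupCohomology.finrank_H1_of_freeGroupBasis
    (Rep.of ((homogRepRat n).comp (CongruenceSubgroup.Gamma m).subtype)) (FreeGroupBasis.ofRepr e)
  constructor
  · obtain ⟨h1, h2⟩ := key 0
    rw [← Module.finrank_eq_rank]
    have h3 : Module.finrank ℚ (Representation.invariants
        ((homogRepRat 0).comp (CongruenceSubgroup.Gamma m).subtype)) = 1 := by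
      have : Representation.invariants
          ((homogRepRat 0).comp (CongruenceSubgroup.Gamma m).subtype) = ⊤ := by
        rw [eq_top_iff]
        exact fun v _ g => homogRepRat_zero g v
      rw [this, finrank_top, finrank_rat_M]
    have h4 : Module.finrank ℚ (H1 m 0) + Module.finrank ℚ (ℚ ⊗[ℤ] M 0) =
      r * Module.finrank ℚ (ℚ ⊗[ℤ] M 0) + Module.finrank ℚ (Representation.invariants
        ((homogRepRat 0).comp (CongruenceSubgroup.Gamma m).subtype)) := h2
    rw [h3, finrank_rat_M] at h4
    congr 1
    omega
  · intro n hn hr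
    obtain ⟨h1, h2⟩ := key n
    rw [← Module.finrank_eq_rank]
    have h4 : Module.finrank ℚ (H1 m n) + Module.finrank ℚ (ℚ ⊗[ℤ] M n) =
      r * Module.finrank ℚ (ℚ ⊗[ℤ] M n) + Module.finrank ℚ (Representation.invariants
        ((homogRepRat n).comp (CongruenceSubgroup.Gamma m).subtype)) := h2
    rw [invariants_eq_bot hm hn, finrank_bot, finrank_rat_M] at h4
    congr 1
    rw [Nat.sub_mul, one_mul]
    omega

end CongruenceCohomology

/-! ### The order of `SL₂(ℤ/m)` and surjectivity of reduction -/

namespace Matrix.SpecialLinearGroup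

/-- The special linear group of a product of rings. -/
def piEquiv {ι : Type*} (R : ι → Type*) [∀ i, CommRing (R i)] :
    SL(2, ∀ i, R i) ≃ ∀ i, SL(2, R i) where
  toFun g i := map (Pi.evalRingHom R i) g
  invFun h := ⟨Matrix.of fun k l i => h i k l, by
    rw [Matrix.det_fin_two]
    ext i
    have := (h i).det_coe
    rw [Matrix.det_fin_two] at this
    exact this⟩
  left_inv g := by ext; rfl
  right_inv h := by ext; rfl

/-- The matrices of determinant one whose upper left entry is a unit. -/
def unitCellEquiv (R : Type*) [CommRing R] :
    {g : SL(2, R) // IsUnit (g 0 0)} ≃ Rˣ × R × R where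
  toFun g := (g.2.unit, g.1 0 1, g.1 1 0)
  invFun x := ⟨⟨!![(x.1 : R), x.2.1; x.2.2, (1 + x.2.1 * x.2.2) * (x.1⁻¹ : Rˣ)], by
    rw [Matrix.det_fin_two_of, mul_left_comm, Units.mul_inv]; ring⟩, by simp⟩
  left_inv := by
    rintro ⟨g, hg⟩
    have hdet := g.det_coe
    rw [Matrix.det_fin_two] at hdet
    refine Subtype.ext (Matrix.SpecialLinearGroup.ext _ _ fun i j => ?_)
    fin_cases i <;> fin_cases j
    · simp
    · simp
    · simp
    · change (1 + g 0 1 * g 1 0) * (hg.unit⁻¹ : Rˣ) = g 1 1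
      rw [← sub_eq_iff_eq_add.1 hdet, mul_right_comm, IsUnit.mul_val_inv, one_mul]
  right_inv := by
    rintro ⟨u, b, c⟩
    refine Prod.ext (Units.ext ?_) (Prod.ext ?_ ?_) <;> simp

/-- The matrices of determinant one over a local ring whose upper left entry is not a unit. -/
def nonunitCellEquiv (R : Type*) [CommRing R] [IsLocalRing R] :
    {g : SL(2, R) // ¬ IsUnit (g 0 0)} ≃ {a : R // ¬ IsUnit a} × Rˣ × R where
  toFun g := (⟨g.1 0 0, g.2⟩, (show IsUnit (g.1 0 1) by
    have hdet := g.1.det_coe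
    rw [Matrix.det_fin_two, sub_eq_add_neg] at hdet
    rcases IsLocalRing.isUnit_or_isUnit_of_add_one hdet with h | h
    · exact absurd (isUnit_of_mul_isUnit_left h) g.2
    · rw [IsUnit.neg_iff] at h
      exact isUnit_of_mul_isUnit_left h).unit, g.1 1 1)
  invFun x := ⟨⟨!![(x.1 : R), (x.2.1 : R); (x.1 * x.2.2 - 1) * (x.2.1⁻¹ : Rˣ), x.2.2], by
    rw [Matrix.det_fin_two_of, mul_left_comm, Units.mul_inv]; ring⟩, by simpa using x.1.2⟩
  left_inv := by
    rintro ⟨g, hg⟩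
    have hdet := g.det_coe
    rw [Matrix.det_fin_two] at hdet
    refine Subtype.ext (Matrix.SpecialLinearGroup.ext _ _ fun i j => ?_)
    fin_cases i <;> fin_cases j
    · simp
    · simp
    · change (g 0 0 * g 1 1 - 1) * (_ : Rˣ) = g 1 0
      have h : g 0 0 * g 1 1 - 1 = g 0 1 * g 1 0 := by linear_combination hdet
      rw [h, mul_right_comm, IsUnit.mul_val_inv, one_mul]
    · simp
  right_inv := by
    rintro ⟨a, u, d⟩
    refine Prod.ext (Subtype.ext ?_) (Prod.ext (Units.ext ?_) ?_) <;> simp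

/-- Split by whether the upper left entry is a unit. If it is not, `ad - bc = 1` in a local ring
forces `b` to be a unit, so each cell is parametrised by three free entries. -/
theorem card_of_isLocalRing (R : Type*) [CommRing R] [IsLocalRing R] [Finite R] :
    Nat.card SL(2, R) = Nat.card Rˣ * Nat.card R *
      (Nat.card R + Nat.card {a : R // ¬ IsUnit a}) := by
  classical
  rw [← Nat.card_congr (Equiv.sumCompl fun g : SL(2, R) => IsUnit (g 0 0)), Nat.card_sum,
    Nat.card_congr (unitCellEquiv R), Nat.card_congr (nonunitCellEquiv R)]
  simp only [Nat.card_prod]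
  ring

/-- With `b = a - 1`, there are `p ^ b * (p - 1)` units and `p ^ b` nonunits, the latter being the
multiples of `p`. -/
theorem card_zmod_prime_pow {p a : ℕ} (hp : p.Prime) (ha : 1 ≤ a) :
    Nat.card SL(2, ZMod (p ^ a)) = p ^ (3 * (a - 1)) * (p * (p ^ 2 - 1)) := by
  obtain ⟨b, rfl⟩ : ∃ b, a = b + 1 := ⟨a - 1, by omega⟩
  have : NeZero (p ^ (b + 1)) := ⟨pow_ne_zero _ hp.ne_zero⟩
  have : Nontrivial (ZMod (p ^ (b + 1))) :=
    ZMod.nontrivial_iff.2 (Nat.one_lt_pow (Nat.succ_ne_zero b) hp.one_lt).ne'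
  have hunit : ∀ x : ZMod (p ^ (b + 1)), IsUnit x ↔ ¬ p ∣ x.val := by
    intro x
    conv_lhs => rw [← ZMod.natCast_zmod_val x]
    rw [ZMod.isUnit_iff_coprime, Nat.coprime_pow_right_iff (Nat.succ_pos b), Nat.coprime_comm,
      hp.coprime_iff_not_dvd]
  have : IsLocalRing (ZMod (p ^ (b + 1))) := by
    refine IsLocalRing.of_nonunits_add fun x y hx hy => ?_
    rw [mem_nonunits_iff, hunit, not_not] at hx hy ⊢
    rw [ZMod.val_add, Nat.dvd_mod_iff (dvd_pow_self p (Nat.succ_ne_zero b))]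
    exact dvd_add hx hy
  have hu : Nat.card (ZMod (p ^ (b + 1)))ˣ = p ^ b * (p - 1) := by
    rw [Nat.card_eq_fintype_card, ZMod.card_units_eq_totient, Nat.totient_prime_pow_succ hp]
  have hR : Nat.card (ZMod (p ^ (b + 1))) = p ^ (b + 1) := by simp
  have hn : Nat.card {x : ZMod (p ^ (b + 1)) // ¬ IsUnit x} = p ^ b := by
    classical
    have h := Nat.card_congr (Equiv.sumCompl fun x : ZMod (p ^ (b + 1)) => IsUnit x)
    rw [Nat.card_sum, ← Nat.card_congr (Equiv.ofBijective (fun u : (ZMod (p ^ (b + 1)))ˣ =>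
      (⟨u, u.isUnit⟩ : {x : ZMod (p ^ (b + 1)) // IsUnit x}))
      ⟨fun u v h => Units.ext (Subtype.ext_iff.1 h), fun x => ⟨x.2.unit, rfl⟩⟩), hu, hR, pow_succ] at h
    obtain ⟨q, rfl⟩ : ∃ q, p = q + 1 := ⟨p - 1, by have := hp.pos; omega⟩
    rw [Nat.add_sub_cancel, mul_add, mul_one] at h
    exact Nat.add_left_cancel h
  rw [card_of_isLocalRing, hu, hR, hn]
  obtain ⟨q, rfl⟩ : ∃ q, p = q + 1 := ⟨p - 1, by have := hp.pos; omega⟩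
  have : (q + 1) ^ 2 - 1 = q * (q + 2) := by
    rw [Nat.sub_eq_iff_eq_add (Nat.one_le_pow _ _ hp.pos)]; ring
  rw [this, Nat.add_sub_cancel, Nat.add_sub_cancel]
  ring

theorem card_zmod {k : ℕ} (p a : Fin k → ℕ) (hp : ∀ j, (p j).Prime)
    (hinj : Function.Injective p) (ha : ∀ j, 1 ≤ a j) :
    Nat.card SL(2, ZMod (∏ j, p j ^ a j)) = ∏ j, p j ^ (3 * (a j - 1)) * (p j * (p j ^ 2 - 1)) := by
  have hco : Pairwise (Function.onFun Nat.Coprime fun j => p j ^ a j) := fun i j hij =>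
    Nat.Coprime.pow _ _ ((Nat.coprime_primes (hp i) (hp j)).2 fun h => hij (hinj h))
  let e := ZMod.prodEquivPi (fun j => p j ^ a j) hco
  have e1 : SL(2, ZMod (∏ j, p j ^ a j)) ≃ SL(2, ∀ j, ZMod (p j ^ a j)) :=
    { toFun := map (e : _ →+* _)
      invFun := map (e.symm : _ →+* _)
      left_inv := fun g => by ext; simp
      right_inv := fun g => by ext; simp }
  rw [Nat.card_congr (e1.trans (piEquiv _)), Nat.card_pi]
  exact Finset.prod_congr rfl fun j _ => card_zmod_prime_pow (hp j) (ha j)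

/-- An integer that is coprime to the gcd of `c` and `m` is congruent modulo `m` to an integer
that is coprime to `c`. -/
theorem exists_isCoprime_add_mul {c m : ℕ} [NeZero c] (d : ℤ)
    (h : IsCoprime d (Nat.gcd c m : ℤ)) : ∃ t : ℤ, IsCoprime (d + t * m) (c : ℤ) := by
  -- Units modulo `gcd c m` lift to units modulo `c`.
  obtain ⟨u, hu⟩ := ZMod.unitsMap_surjective (Nat.gcd_dvd_left c m)
    (ZMod.unitOfIsCoprime d h)
  have hu' : (ZMod.castHom (Nat.gcd_dvd_left c m) (ZMod (Nat.gcd c m))) (u : ZMod c) = (d : ZMod _) :=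
    congrArg Units.val hu
  have hval : (((u : ZMod c).val : ℤ) : ZMod c) = u := by simp
  have hcop : IsCoprime (((u : ZMod c).val : ℤ)) (c : ℤ) := by
    rw [Nat.isCoprime_iff_coprime]
    exact ZMod.val_coe_unit_coprime u
  have hdvd : (Nat.gcd c m : ℤ) ∣ ((u : ZMod c).val : ℤ) - d := by
    rw [← ZMod.intCast_zmod_eq_zero_iff_dvd]
    rw [Int.cast_sub, ← hu', ← hval, map_intCast]
    simp
  obtain ⟨s, hs⟩ := hdvd
  -- Bézout splits the difference into a multiple of `m`, which supplies `t`, and a multiple of `c`,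
  -- which is harmless for coprimality.
  rw [Nat.gcd_eq_gcd_ab] at hs
  refine ⟨Nat.gcdB c m * s, ?_⟩
  have : d + Nat.gcdB c m * s * m = ((u : ZMod c).val : ℤ) + (c : ℤ) * (-(Nat.gcdA c m * s)) := by
    linear_combination -hs
  rw [this]
  exact hcop.add_mul_left_left _

/-- Reduction modulo `m` is surjective on `SL(2)`. -/
theorem map_zmod_surjective (m : ℕ) [NeZero m] :
    Function.Surjective (map (n := Fin 2) (Int.castRingHom (ZMod m))) := by
  intro g
  have hdet := g.det_coe
  rw [Matrix.det_fin_two] at hdet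
  obtain ⟨a, ha⟩ := ZMod.intCast_surjective (g 0 0)
  obtain ⟨b, hb⟩ := ZMod.intCast_surjective (g 0 1)
  obtain ⟨d, hd⟩ := ZMod.intCast_surjective (g 1 1)
  -- Adding `m` keeps the lift of the lower left entry nonzero, as the coprimality lemma requires.
  obtain ⟨c, hc0, hc⟩ : ∃ c : ℕ, c ≠ 0 ∧ (c : ZMod m) = g 1 0 :=
    ⟨(g 1 0).val + m, by have := NeZero.ne m; omega, by simp⟩
  have : NeZero c := ⟨hc0⟩
  rw [← ha, ← hb, ← hc, ← hd] at hdet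
  have hdvd : (m : ℤ) ∣ a * d - b * c - 1 := by
    rw [← ZMod.intCast_zmod_eq_zero_iff_dvd]
    push_cast
    rw [hdet, sub_self]
  obtain ⟨k, hk⟩ := hdvd
  obtain ⟨c', hc'⟩ : (Nat.gcd c m : ℤ) ∣ c := Int.natCast_dvd_natCast.2 (Nat.gcd_dvd_left c m)
  obtain ⟨m', hm'⟩ : (Nat.gcd c m : ℤ) ∣ m := Int.natCast_dvd_natCast.2 (Nat.gcd_dvd_right c m)
  obtain ⟨t, x, y, hxy⟩ := exists_isCoprime_add_mul (c := c) (m := m) d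
    ⟨a, -(b * c' + m' * k), by linear_combination hk + b * hc' + k * hm'⟩
  -- With the bottom row made coprime, the determinant is `1 + m * (k + a * t)`. The Bézout
  -- coefficients `x`, `y` remove the excess by changing the top row by multiples of `m`.
  refine ⟨⟨!![a - m * (k + a * t) * x, b + m * (k + a * t) * y; (c : ℤ), d + t * m], ?_⟩, ?_⟩
  · rw [Matrix.det_fin_two_of]
    linear_combination hk - m * (k + a * t) * hxy
  · refine Matrix.SpecialLinearGroup.ext _ _ fun i j => ?_
    fin_cases i <;> fin_cases j
    · change ((a - m * (k + a * t) * x : ℤ) : ZMod m) = g 0 0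
      simp [ha]
    · change ((b + m * (k + a * t) * y : ℤ) : ZMod m) = g 0 1
      simp [hb]
    · change (((c : ℕ) : ℤ) : ZMod m) = g 1 0
      simp [hc]
    · change ((d + t * m : ℤ) : ZMod m) = g 1 1
      simp [hd]

end Matrix.SpecialLinearGroup

/-! ### `PSL₂(ℤ)` as a free product, and freeness of `Γ(m)` -/

namespace ModularGroup

open Matrix Monoid Subgroup

/-- The action of `SL(2, ℤ)` on bilinear forms by congruence. -/
def congruenceAction : SL(2, ℤ) →* Equiv.Perm (Matrix (Fin 2) (Fin 2) ℤ) where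
  toFun g :=
    { toFun := fun A => (g : Matrix (Fin 2) (Fin 2) ℤ) * A * (g : Matrix (Fin 2) (Fin 2) ℤ)ᵀ
      invFun := fun A => ((g⁻¹ : SL(2, ℤ)) : Matrix (Fin 2) (Fin 2) ℤ) * A *
        ((g⁻¹ : SL(2, ℤ)) : Matrix (Fin 2) (Fin 2) ℤ)ᵀ
      left_inv := fun A => by
        have h : ((g⁻¹ : SL(2, ℤ)) : Matrix (Fin 2) (Fin 2) ℤ) * g = 1 :=
          congrArg Subtype.val (inv_mul_cancel g)
        simp only [← Matrix.mul_assoc, h, Matrix.one_mul]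
        rw [Matrix.mul_assoc, ← Matrix.transpose_mul, h, Matrix.transpose_one, Matrix.mul_one]
      right_inv := fun A => by
        have h : (g : Matrix (Fin 2) (Fin 2) ℤ) * ((g⁻¹ : SL(2, ℤ)) : Matrix (Fin 2) (Fin 2) ℤ) =
            1 := congrArg Subtype.val (mul_inv_cancel g)
        simp only [← Matrix.mul_assoc, h, Matrix.one_mul]
        rw [Matrix.mul_assoc, ← Matrix.transpose_mul, h, Matrix.transpose_one, Matrix.mul_one] }
  map_one' := by ext A : 1; simp
  map_mul' g h := by
    ext A : 1
    simp [Matrix.mul_assoc, Matrix.transpose_mul]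

theorem congruenceAction_apply (g : SL(2, ℤ)) (A : Matrix (Fin 2) (Fin 2) ℤ) :
    congruenceAction g A = (g : Matrix (Fin 2) (Fin 2) ℤ) * A * (g : Matrix (Fin 2) (Fin 2) ℤ)ᵀ :=
  rfl

theorem mem_ker_congruenceAction {g : SL(2, ℤ)} :
    g ∈ congruenceAction.ker ↔ g = 1 ∨ g = -1 := by
  rw [MonoidHom.mem_ker]
  constructor
  · intro h
    have hA : ∀ A, (g : Matrix (Fin 2) (Fin 2) ℤ) * A * (g : Matrix (Fin 2) (Fin 2) ℤ)ᵀ = A :=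
      fun A => DFunLike.congr_fun h A
    -- Matrix units suffice: these entries give `g₀₀² = 1`, `g₁₀ = 0`, `g₀₁ = 0` and `g₀₀ g₁₁ = 1`.
    have h1 := congrFun (congrFun (hA !![1, 0; 0, 0]) 0) 0
    have h2 := congrFun (congrFun (hA !![1, 0; 0, 0]) 1) 1
    have h3 := congrFun (congrFun (hA !![0, 0; 0, 1]) 0) 0
    have h4 := congrFun (congrFun (hA !![0, 1; 0, 0]) 0) 1
    simp [Matrix.mul_apply, Fin.sum_univ_two] at h1 h2 h3 h4
    rcases mul_self_eq_one_iff.1 h1 with h | h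
    · rw [h, one_mul] at h4
      left
      ext i j
      fin_cases i <;> fin_cases j <;> simp [h, h2, h3, h4]
    · rw [h, neg_one_mul, neg_eq_iff_eq_neg] at h4
      right
      ext i j
      fin_cases i <;> fin_cases j <;> simp [h, h2, h3, h4]
  · rintro (rfl | rfl)
    · exact map_one _
    · ext A : 1
      rw [congruenceAction_apply]
      simp

theorem congruenceAction_eq_iff {g h : SL(2, ℤ)} :
    congruenceAction g = congruenceAction h ↔ g = h ∨ g = -h := by
  rw [← mul_inv_eq_one, ← map_inv, ← map_mul, ← MonoidHom.mem_ker, mem_ker_congruenceAction,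
    mul_inv_eq_one, mul_inv_eq_iff_eq_mul, neg_one_mul]

theorem card_ker_congruenceAction : Nat.card congruenceAction.ker = 2 := by
  have h : (congruenceAction.ker : Set SL(2, ℤ)) = {1, -1} := by
    ext g
    exact mem_ker_congruenceAction
  change Nat.card ((congruenceAction.ker : Set SL(2, ℤ)) : Type) = 2
  rw [h, Nat.card_coe_set_eq, Set.ncard_pair]
  decide

/-- The standard elliptic elements of `SL(2, ℤ)`, whose images in `PSL(2, ℤ)` have orders `2`
and `3`. -/
def elliptic : Fin 2 → SL(2, ℤ) := ![S, T * S]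

theorem congruenceAction_S (A : Matrix (Fin 2) (Fin 2) ℤ) :
    congruenceAction S A = !![A 1 1, -A 1 0; -A 0 1, A 0 0] := by
  rw [congruenceAction_apply, show (S : Matrix (Fin 2) (Fin 2) ℤ) = !![0, -1; 1, 0] from rfl]
  ext i j
  simp only [Matrix.mul_apply, Fin.sum_univ_two, Matrix.transpose_apply]
  fin_cases i <;> fin_cases j <;> simp

theorem congruenceAction_TS (A : Matrix (Fin 2) (Fin 2) ℤ) :
    congruenceAction (T * S) A =
      !![A 0 0 - A 1 0 - A 0 1 + A 1 1, A 0 0 - A 1 0; A 0 0 - A 0 1, A 0 0] := by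
  have hTS : ((T * S : SL(2, ℤ)) : Matrix (Fin 2) (Fin 2) ℤ) = !![1, -1; 1, 0] := by decide
  rw [congruenceAction_apply, hTS]
  ext i j
  simp only [Matrix.mul_apply, Fin.sum_univ_two, Matrix.transpose_apply]
  fin_cases i <;> fin_cases j <;> simp <;> ring

theorem congruenceAction_elliptic_pow (i : Fin 2) :
    congruenceAction (elliptic i) ^ (i.val + 2) = 1 := by
  fin_cases i
  · ext A : 1
    change congruenceAction S (congruenceAction S A) = A
    simp only [congruenceAction_S]
    ext i j
    fin_cases i <;> fin_cases j <;> simp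
  · ext A : 1
    change congruenceAction (T * S) (congruenceAction (T * S) (congruenceAction (T * S) A)) = A
    simp only [congruenceAction_TS]
    ext i j
    fin_cases i <;> fin_cases j <;> simp <;> ring

theorem congruenceAction_elliptic_ne_one (i : Fin 2) : congruenceAction (elliptic i) ≠ 1 := by
  intro h
  rcases mem_ker_congruenceAction.1 h with h | h <;> revert h <;> fin_cases i <;> decide

theorem orderOf_congruenceAction_elliptic (i : Fin 2) :
    orderOf (congruenceAction (elliptic i)) = i.val + 2 := by
  have hp : Fact (Nat.Prime (i.val + 2)) := ⟨by fin_cases i <;> norm_num⟩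
  exact orderOf_eq_prime (congruenceAction_elliptic_pow i) (congruenceAction_elliptic_ne_one i)

/-- The free factors of `PSL(2, ℤ)`. -/
abbrev EllipticGroup (i : Fin 2) : Type := zpowers (congruenceAction (elliptic i))

theorem card_ellipticGroup (i : Fin 2) : Nat.card (EllipticGroup i) = i.val + 2 := by
  rw [Nat.card_zpowers, orderOf_congruenceAction_elliptic]

instance (i : Fin 2) : Finite (EllipticGroup i) :=
  Nat.finite_of_card_ne_zero (by rw [card_ellipticGroup]; omega)

theorem EllipticGroup.cases_zero (h : EllipticGroup 0) :
    h = 1 ∨ (h : Equiv.Perm _) = congruenceAction S := by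
  obtain ⟨_, k, rfl⟩ := h
  have h0 := Int.emod_nonneg k (b := 2) (by norm_num)
  have h1 := Int.emod_lt_of_pos k (b := 2) (by norm_num)
  have h2 := zpow_eq_zpow_emod k (x := congruenceAction S) (n := 2)
    (by exact_mod_cast congruenceAction_elliptic_pow 0)
  generalize k % 2 = l at h0 h1 h2
  interval_cases l
  · exact Or.inl (Subtype.ext (h2.trans (zpow_zero _)))
  · exact Or.inr (h2.trans (zpow_one _))

theorem EllipticGroup.cases_one (h : EllipticGroup 1) :
    h = 1 ∨ (h : Equiv.Perm _) = congruenceAction (T * S) ∨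
      (h : Equiv.Perm _) = congruenceAction (T * S * (T * S)) := by
  obtain ⟨_, k, rfl⟩ := h
  have h0 := Int.emod_nonneg k (b := 3) (by norm_num)
  have h1 := Int.emod_lt_of_pos k (b := 3) (by norm_num)
  have h2 := zpow_eq_zpow_emod k (x := congruenceAction (T * S)) (n := 3)
    (by exact_mod_cast congruenceAction_elliptic_pow 1)
  generalize k % 3 = l at h0 h1 h2
  interval_cases l
  · exact Or.inl (Subtype.ext (h2.trans (zpow_zero _)))
  · exact Or.inr (Or.inl (h2.trans (zpow_one _)))
  · right; right
    rw [map_mul, ← zpow_two]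
    exact h2

/-- The comparison of the free product of cyclic groups of orders `2` and `3` with `PSL(2, ℤ)`. -/
def freeProductHom : CoprodI EllipticGroup →* Equiv.Perm (Matrix (Fin 2) (Fin 2) ℤ) :=
  CoprodI.lift fun i => (zpowers (congruenceAction (elliptic i))).subtype

-- Ping-pong between the matrices with positive diagonal and negative, respectively positive,
-- off-diagonal entries. On `A = v vᵀ` these record the sign of `v₀ v₁`, as in the classical game on
-- the projective line. The factor of order 3 meets the size condition of the ping-pong lemma.
open scoped Pointwise in
theorem freeProductHom_injective : Function.Injective freeProductHom := by
  refine CoprodI.lift_injective_of_ping_pong _ (Or.inr ⟨1, ?_⟩)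
    (![{A | 0 < A 0 0 ∧ 0 < A 1 1 ∧ A 0 1 < 0 ∧ A 1 0 < 0},
      {A | 0 < A 0 0 ∧ 0 < A 1 1 ∧ 0 < A 0 1 ∧ 0 < A 1 0}] :
      Fin 2 → Set (Matrix (Fin 2) (Fin 2) ℤ)) ?_ ?_ ?_
  · rw [← Nat.cast_card, card_ellipticGroup]
    norm_num
  · intro i
    fin_cases i
    · exact ⟨!![1, -1; -1, 1], by simp⟩
    · exact ⟨!![1, 1; 1, 1], by simp⟩
  · intro i j hij
    rw [Function.onFun, Set.disjoint_left]
    fin_cases i <;> fin_cases j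
    · exact absurd rfl hij
    · rintro A ⟨_, _, h, _⟩ ⟨_, _, h', _⟩
      exact lt_asymm h h'
    · rintro A ⟨_, _, h, _⟩ ⟨_, _, h', _⟩
      exact lt_asymm h h'
    · exact absurd rfl hij
  · intro i j hij h hh
    rintro _ ⟨A, hA, rfl⟩
    fin_cases i <;> fin_cases j
    · exact absurd rfl hij
    · obtain ⟨h1, h2, h3, h4⟩ := hA
      rcases EllipticGroup.cases_zero h with rfl | h'
      · exact absurd rfl hh
      · change (h : Equiv.Perm _) A ∈
          {A : Matrix (Fin 2) (Fin 2) ℤ | 0 < A 0 0 ∧ 0 < A 1 1 ∧ A 0 1 < 0 ∧ A 1 0 < 0}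
        rw [h', congruenceAction_S]
        simp [h1, h2, h3, h4]
    · obtain ⟨h1, h2, h3, h4⟩ := hA
      change (h : Equiv.Perm _) A ∈
          {A : Matrix (Fin 2) (Fin 2) ℤ | 0 < A 0 0 ∧ 0 < A 1 1 ∧ 0 < A 0 1 ∧ 0 < A 1 0}
      rcases EllipticGroup.cases_one h with rfl | h' | h'
      · exact absurd rfl hh
      · rw [h', congruenceAction_TS]
        simp
        omega
      · rw [h', map_mul, Equiv.Perm.mul_apply, congruenceAction_TS, congruenceAction_TS]
        simp
        omega
    · exact absurd rfl hij

/-- `S` and `T = (T S) S⁻¹` generate `SL(2, ℤ)`. -/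
theorem range_freeProductHom : freeProductHom.range = congruenceAction.range := by
  have hle : ∀ i, congruenceAction (elliptic i) ∈ freeProductHom.range := fun i =>
    ⟨CoprodI.of (⟨_, mem_zpowers _⟩ : EllipticGroup i), by
      rw [freeProductHom, CoprodI.lift_of]; rfl⟩
  refine le_antisymm ?_ ?_
  · refine CoprodI.lift_range_le _ _ fun i => ?_
    rw [Subgroup.range_subtype, zpowers_le]
    exact ⟨_, rfl⟩
  · rw [MonoidHom.range_eq_map, ← SpecialLinearGroup.SL2Z_generators, MonoidHom.map_closure,
      closure_le]
    rintro _ ⟨g, rfl | rfl, rfl⟩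
    · exact hle 0
    · have := mul_mem (hle 1) (inv_mem (hle 0))
      rwa [← map_inv, ← map_mul, show elliptic 1 * (elliptic 0)⁻¹ = T from
        mul_inv_cancel_right T S] at this

section Level

variable {m : ℕ}

theorem eq_one_of_congruenceAction_eq (hm : 2 < m) {γ : SL(2, ℤ)}
    (hγ : γ ∈ CongruenceSubgroup.Gamma m) (i : Fin 2) (h : EllipticGroup i)
    (hh : (h : Equiv.Perm _) = congruenceAction γ) : h = 1 := by
  have h01 : (0 : ZMod m) ≠ 1 := by
    have : Fact (1 < m) := ⟨by omega⟩
    exact zero_ne_one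
  -- `S`, `TS` and `(TS)²` each have a zero on the diagonal, whereas diagonal entries of `±γ` are
  -- `±1` modulo `m`.
  have key : ∀ g : SL(2, ℤ), (g 0 0 = 0 ∨ g 1 1 = 0) →
      congruenceAction g ≠ congruenceAction γ := by
    intro g hg h
    rw [CongruenceSubgroup.Gamma_mem] at hγ
    rcases congruenceAction_eq_iff.1 h with rfl | rfl <;>
      rcases hg with hg | hg
    · exact h01 (by rw [← hγ.1, hg, Int.cast_zero])
    · exact h01 (by rw [← hγ.2.2.2, hg, Int.cast_zero])
    · rw [SpecialLinearGroup.coe_neg, Matrix.neg_apply, neg_eq_zero] at hg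
      exact h01 (by rw [← hγ.1, hg, Int.cast_zero])
    · rw [SpecialLinearGroup.coe_neg, Matrix.neg_apply, neg_eq_zero] at hg
      exact h01 (by rw [← hγ.2.2.2, hg, Int.cast_zero])
  fin_cases i
  · exact (EllipticGroup.cases_zero h).resolve_right fun h' =>
      key S (Or.inl (by decide)) (h'.symm.trans hh)
  · rcases EllipticGroup.cases_one h with h' | h' | h'
    · exact h'
    · exact absurd (h'.symm.trans hh) (key _ (Or.inr (by decide)))
    · exact absurd (h'.symm.trans hh) (key _ (Or.inl (by decide)))

/-- If `-1` lay in `Γ(m)`, then `m` would divide 2. -/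
theorem disjoint_Gamma_ker (hm : 2 < m) :
    CongruenceSubgroup.Gamma m ⊓ congruenceAction.ker = ⊥ := by
  rw [eq_bot_iff]
  rintro g ⟨hg, hk⟩
  rcases mem_ker_congruenceAction.1 hk with rfl | rfl
  · exact one_mem _
  · have h : ((-1 : ℤ) : ZMod m) = 1 := (CongruenceSubgroup.Gamma_mem.1 hg).1
    have h2 : ((2 : ℕ) : ZMod m) = 0 := by
      push_cast at h ⊢
      linear_combination -h
    rw [ZMod.natCast_eq_zero_iff] at h2
    exact absurd (Nat.le_of_dvd two_pos h2) (by omega)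

theorem index_Gamma (m : ℕ) [NeZero m] :
    (CongruenceSubgroup.Gamma m).index = Nat.card SL(2, ZMod m) := by
  rw [CongruenceSubgroup.Gamma, Subgroup.index_ker,
    MonoidHom.range_eq_top.2 (SpecialLinearGroup.map_zmod_surjective m), Subgroup.card_top]

/-- The preimage in `SL(2, ℤ)` of the image of `Γ(m)` is `Γ(m) · {1, -1}`, which contains `Γ(m)`
with index 2. -/
theorem index_comap_map_Gamma (hm : 2 < m) :
    2 * (((CongruenceSubgroup.Gamma m).map congruenceAction).comap freeProductHom).index =
      Nat.card SL(2, ZMod m) := by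
  have : NeZero m := ⟨by omega⟩
  have hn := CongruenceSubgroup.Gamma_normal m
  rw [Subgroup.index_comap, range_freeProductHom, ← Subgroup.index_comap, Subgroup.comap_map_eq,
    ← index_Gamma, ← Subgroup.relIndex_mul_index
      (le_sup_left : CongruenceSubgroup.Gamma m ≤ CongruenceSubgroup.Gamma m ⊔ congruenceAction.ker)]
  congr 1
  rw [sup_comm, Subgroup.relIndex_sup_right, ← Subgroup.inf_relIndex_right,
    disjoint_Gamma_ker hm, Subgroup.relIndex_bot_left, card_ker_congruenceAction]

theorem congruenceAction_injective_Gamma (hm : 2 < m) :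
    Function.Injective (congruenceAction.comp (CongruenceSubgroup.Gamma m).subtype) := by
  rw [injective_iff_map_eq_one]
  intro g hg
  have : (g : SL(2, ℤ)) ∈ CongruenceSubgroup.Gamma m ⊓ congruenceAction.ker := ⟨g.2, hg⟩
  rw [disjoint_Gamma_ker hm, Subgroup.mem_bot] at this
  exact Subtype.ext this

/-- The principal congruence subgroup as a subgroup of the free product. -/
def GammaEquiv (hm : 2 < m) : CongruenceSubgroup.Gamma m ≃*
    ((CongruenceSubgroup.Gamma m).map congruenceAction).comap freeProductHom :=
  have h : (((CongruenceSubgroup.Gamma m).map congruenceAction).comap freeProductHom).map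
      freeProductHom = (congruenceAction.comp (CongruenceSubgroup.Gamma m).subtype).range := by
    rw [Subgroup.map_comap_eq_self, MonoidHom.range_comp, Subgroup.range_subtype]
    rw [range_freeProductHom, MonoidHom.range_eq_map]
    exact Subgroup.map_mono le_top
  (MonoidHom.ofInjective (congruenceAction_injective_Gamma hm)).trans
    ((MulEquiv.subgroupCongr h.symm).trans
      (Subgroup.equivMapOfInjective _ _ freeProductHom_injective).symm)

/-- The principal congruence subgroup of level `m > 2` is free, and its rank is determined by the
order of `SL(2, ℤ/m)`. -/
theorem exists_Gamma_mulEquiv_freeGroup (hm : 2 < m) :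
    ∃ r : ℕ, Nonempty (CongruenceSubgroup.Gamma m ≃* FreeGroup (Fin r)) ∧
      12 * r = Nat.card SL(2, ZMod m) + 12 := by
  have : NeZero m := ⟨by omega⟩
  have hindex := index_comap_map_Gamma hm
  have : (((CongruenceSubgroup.Gamma m).map congruenceAction).comap freeProductHom).FiniteIndex :=
    ⟨fun h => by
      rw [h, mul_zero] at hindex
      exact Nat.card_pos.ne hindex⟩
  obtain ⟨hdvd, r, ⟨e⟩, hr⟩ := FreeProductAction.exists_mulEquiv_freeGroup
    (((CongruenceSubgroup.Gamma m).map congruenceAction).comap freeProductHom) (by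
      rintro i h q ⟨γ, hγ, hq⟩
      -- Normality of `Γ(m)` reduces conjugates of the factors to the factors themselves.
      obtain ⟨g, hg⟩ : freeProductHom q ∈ congruenceAction.range :=
        range_freeProductHom ▸ ⟨q, rfl⟩
      refine eq_one_of_congruenceAction_eq hm
        ((CongruenceSubgroup.Gamma_normal m).conj_mem γ hγ g) i h ?_
      have hh : freeProductHom (CoprodI.of h) = h := by
        rw [freeProductHom, CoprodI.lift_of]; rfl
      rw [map_mul, map_mul, hq, hg, map_mul, map_mul, map_inv, map_inv, hg, hh]
      group)
  refine ⟨r, ⟨(GammaEquiv hm).trans e⟩, ?_⟩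
  have h0 := hdvd 0
  have h1 := hdvd 1
  rw [Fin.sum_univ_two] at hr
  simp only [card_ellipticGroup] at h0 h1 hr
  change 2 ∣ _ at h0
  change 3 ∣ _ at h1
  -- With `N` the index, `r + N = 1 + N/2 + 2(N/3)`. Both divisions are exact, so `r = 1 + N/6`, and
  -- `2N` is the order of `SL(2, ZMod m)`.
  change r + _ = 1 + (1 * (_ / 2) + 2 * (_ / 3)) at hr
  omega

end Level

end ModularGroup

end

theorem mainTheorem5 {k : ℕ} [NeZero k] (p a : Fin k → ℕ)
    (hp : ∀ j, (p j).Prime) (hinj : Function.Injective p) (ha : ∀ j, 1 ≤ a j)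
    (m : ℕ) (hm : 2 < m) (hfac : m = ∏ j, p j ^ a j)
    (d : ℕ) (hd : d = ∏ j, p j ^ (3 * (a j - 1)) * (p j * (p j ^ 2 - 1)))
    (i : ℚ) (hi : i = (d : ℚ) / ((p 0 : ℚ) * ((p 0 : ℚ) ^ 2 - 1))) :
    Nat.card SL(2, ZMod m) = d ∧
    ∃ r : ℕ,
      (r : ℚ) = (if p 0 = 2 then i / 2 + 1
        else i * ((p 0 : ℚ) * ((p 0 : ℚ) ^ 2 - 1) / 12) + 1) ∧
      Nonempty (CongruenceSubgroup.Gamma m ≃* FreeGroup (Fin r)) ∧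
      Module.rank ℚ (CongruenceCohomology.H1 m 0) = (r : Cardinal) ∧
      ∀ n : ℕ, 0 < n →
        Module.rank ℚ (CongruenceCohomology.H1 m n) = (((r - 1) * (n + 1) : ℕ) : Cardinal) := by
  have hcard : Nat.card SL(2, ZMod m) = d := by
    rw [hfac, hd]
    exact Matrix.SpecialLinearGroup.card_zmod p a hp hinj ha
  obtain ⟨r, ⟨e⟩, hr⟩ := ModularGroup.exists_Gamma_mulEquiv_freeGroup hm
  obtain ⟨h0, hpos⟩ := CongruenceCohomology.rank_H1 (by omega) e
  refine ⟨hcard, r, ?_, ⟨e⟩, h0, fun n hn => hpos n hn (by omega)⟩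
  rw [hcard] at hr
  have hr' : 12 * (r : ℚ) = d + 12 := by exact_mod_cast hr
  -- For `p 0 = 2` the factor `p (p² - 1)` is 6, so `i / 2 = d / 12`; in the other case the factor
  -- cancels. Both cases say `r = d / 12 + 1`.
  split_ifs with h2
  · rw [hi, h2]
    push_cast
    linarith
  · have hq : (2 : ℚ) ≤ p 0 := by exact_mod_cast (hp 0).two_le
    have hne : (p 0 : ℚ) * ((p 0 : ℚ) ^ 2 - 1) ≠ 0 :=
      mul_ne_zero (by linarith) (by nlinarith)
    rw [hi, ← mul_div_assoc, div_mul_cancel₀ _ hne]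
    linarith
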